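/- Let $(\mathfrak g,[\cdot,\cdot],\|\cdot\|)$ be a Banach--Malcev algebra over $\mathbb K\in\{\mathbb R,\mathbb C\}$: a Banach space with a bilinear antisymmetric bracket satisfying the Malcev identity $$[[x,y],[x,z]]=[[[x,y],z],x]+[[[y,z],x],x]+[[[z,x],x],y],$$ and let $B\ge 0$ satisfy $\|[x,y]\|\le B\|x\|\,\|y\|$ for all $x,y\in\mathfrak g$. Assume that $\mathfrak g$ is special: there are a unital alternative $\mathbb K$-algebra $\mathcal A$ and an injective linear map $\iota:\mathfrak g\to\mathcal A$ with $\iota([x,y])=\iota(x)\iota(y)-\iota(y)\iota(x)$. For $n\ge 1$ let $\mathcal T_n$ be the set of full binary trees with $n$ leaves, each leaf labeled by $x$ or $y$, and let $[x,y]_T$ be the iterated bracket prescribed by the tree $T$. Let $(\alpha_T)$ be rational BCH coefficients: for every $n$, $\sum_{T\in\mathcal T_n}\alpha_T[X,Y]_T$ is the homogeneous component of degree $n$ of $\log(\exp(X)\exp(Y))$ in the free associative algebra over $\mathbb Q$ on $X,Y$ with the commutator bracket. Let $K\ge 1$ satisfy $|\alpha_T|\le K$ for all $T$. For $x,y\in\mathfrak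 g$ the BCH series is $$\operatorname{BCH}(x,y)=\sum_{n\ge1}Z_n(x,y),\qquad Z_n(x,y)=\sum_{T\in\mathcal T_n}\alpha_T[x,y]_T .$$ If $\|x\|<\frac1{4KB}$ and $\|y\|<\frac1{4KB}$ (no condition if $B=0$), then $\operatorname{BCH}(x,y)$ converges absolutely: $\sum_{n\ge1}\|Z_n(x,y)\|<\infty$. Here it is the series of $\log(\exp(x)\exp(y))$ in $\mathcal A$: for every $n$, $\iota(Z_n(x,y))$ is the homogeneous component of degree $n$ of the formal series $\log(\exp(\iota x)\exp(\iota y))$. -/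

import Mathlib

open scoped Nat

/-- Malcev algebras: a bilinear antisymmetric bracket satisfying the Malcev identity
`[[x,y],[x,z]] = [[[x,y],z],x] + [[[y,z],x],x] + [[[z,x],x],y]`. -/
class MalcevAlgebra (𝕜 𝔤 : Type*) [Field 𝕜] [AddCommGroup 𝔤] [Module 𝕜 𝔤] [Bracket 𝔤 𝔤] :
    Prop where
  add_bracket : ∀ x y z : 𝔤, ⁅x + y, z⁆ = ⁅x, z⁆ + ⁅y, z⁆
  smul_bracket : ∀ (c : 𝕜) (x y : 𝔤), ⁅c • x, y⁆ = c • ⁅x, y⁆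
  skew : ∀ x y : 𝔤, ⁅x, y⁆ = -⁅y, x⁆
  malcev : ∀ x y z : 𝔤,
    ⁅⁅x, y⁆, ⁅x, z⁆⁆ = ⁅⁅⁅x, y⁆, z⁆, x⁆ + ⁅⁅⁅y, z⁆, x⁆, x⁆ + ⁅⁅⁅z, x⁆, x⁆, y⁆

/-- Alternative rings: the left and right alternative laws. -/
class AlternativeRing (A : Type*) [NonAssocRing A] : Prop where
  left_alt : ∀ a b : A, (a * a) * b = a * (a * b)
  right_alt : ∀ a b : A, (b * a) * a = b * (a * a)

/-- An embedding of the bracket algebra `𝔤` into the commutator algebra of `A`. -/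
structure IsCommutatorEmbedding {𝕜 𝔤 A : Type*} [Field 𝕜] [AddCommGroup 𝔤] [Module 𝕜 𝔤]
    [Bracket 𝔤 𝔤] [NonAssocRing A] [Module 𝕜 A] (ι : 𝔤 →ₗ[𝕜] A) : Prop where
  injective : Function.Injective ι
  map_bracket : ∀ x y : 𝔤, ι ⁅x, y⁆ = ι x * ι y - ι y * ι x

/-- Full binary trees whose leaves are labeled by `x` or `y`. -/
inductive BCHTree : Type
  | x : BCHTree
  | y : BCHTree
  | node : BCHTree → BCHTree → BCHTree

namespace BCHTree

/-- The number of leaves. -/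
def leaves : BCHTree → ℕ
  | x => 1
  | y => 1
  | node l r => l.leaves + r.leaves

/-- The iterated bracket `[a, b]_T` prescribed by the tree `T`. -/
def eval {L : Type*} [Bracket L L] (a b : L) : BCHTree → L
  | x => a
  | y => b
  | node l r => ⁅l.eval a b, r.eval a b⁆

theorem leaves_pos (T : BCHTree) : 0 < T.leaves := by
  induction T with
  | x => simp [leaves]
  | y => simp [leaves]
  | node l r hl hr => simp only [leaves]; omega

theorem finite_leaves_le (n : ℕ) : {T : BCHTree | T.leaves ≤ n}.Finite := by
  induction n with
  | zero =>
    refine Set.finite_empty.subset fun T hT => ?_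
    have h1 := leaves_pos T
    simp only [Set.mem_ofPred_eq] at hT
    omega
  | succ n ih =>
    refine (((Set.finite_singleton x).union (Set.finite_singleton y)).union
      (ih.image2 node ih)).subset fun T hT => ?_
    cases T with
    | x => simp
    | y => simp
    | node l r =>
      have hl := leaves_pos l
      have hr := leaves_pos r
      simp only [Set.mem_ofPred_eq, leaves] at hT
      refine Or.inr ⟨l, ?_, r, ?_, rfl⟩ <;> simp only [Set.mem_ofPred_eq] <;> omega

theorem finite_leaves_eq (n : ℕ) : {T : BCHTree | T.leaves = n}.Finite :=
  (finite_leaves_le n).subset fun _ hT => le_of_eq hT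

/-- The finite set of labeled full binary trees with `n` leaves. -/
noncomputable def withLeaves (n : ℕ) : Finset BCHTree := (finite_leaves_eq n).toFinset

theorem mem_withLeaves {n : ℕ} {T : BCHTree} : T ∈ withLeaves n ↔ T.leaves = n := by
  simp [withLeaves]

end BCHTree

section LogExpExp

variable (R : Type*) {A : Type*} [Field R] [NonAssocRing A] [Module R A]

/-- The power `a ^ n` (right-nested), in a possibly non-associative ring. -/
def nestedPow (a : A) : ℕ → A
  | 0 => 1
  | n + 1 => a * nestedPow a n

/-- The homogeneous component of degree `n` of `exp(a) exp(b)`. -/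
def expMulExpComponent (a b : A) (n : ℕ) : A :=
  ∑ p ∈ Finset.HasAntidiagonal.antidiagonal n,
    (((p.1)! : R)⁻¹ • nestedPow a p.1) * (((p.2)! : R)⁻¹ • nestedPow b p.2)

/-- The homogeneous component of degree `n` of `(exp(a) exp(b) - 1) ^ k` (right-nested power). -/
def expMulExpSubOnePowComponent (a b : A) : ℕ → ℕ → A
  | 0, n => if n = 0 then 1 else 0
  | k + 1, n => ∑ p ∈ Finset.HasAntidiagonal.antidiagonal n,
      (if p.1 = 0 then 0 else expMulExpComponent R a b p.1) *
        expMulExpSubOnePowComponent a b k p.2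

/-- The homogeneous component of degree `n` of
`log(exp(a) exp(b)) = ∑_{k ≥ 1} (-1)^(k+1) / k • (exp(a) exp(b) - 1) ^ k`;
only the `k ≤ n` contribute to degree `n`. -/
def logExpMulExpComponent (a b : A) (n : ℕ) : A :=
  ∑ k ∈ Finset.Icc 1 n, ((-1 : R) ^ (k + 1) / (k : R)) • expMulExpSubOnePowComponent R a b k n

end LogExpExp

/-- `α` is a system of Baker-Campbell-Hausdorff coefficients: in the free associative algebra on
two letters `X`, `Y`, the component of degree `n` of `log(exp(X) exp(Y))` is
`∑_T α_T [X, Y]_T`, over the trees with `n` leaves, for every `n`. -/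
def IsBCHCoefficients (α : BCHTree → ℚ) : Prop :=
  ∀ n : ℕ,
    ∑ T ∈ BCHTree.withLeaves n,
        α T • T.eval (FreeAlgebra.ι ℚ false) (FreeAlgebra.ι ℚ true) =
      logExpMulExpComponent ℚ (FreeAlgebra.ι ℚ false) (FreeAlgebra.ι ℚ true) n

/-- The homogeneous term `Z_n(x, y) = ∑_T α_T [x, y]_T` of the BCH series. -/
noncomputable def bchTerm (𝕜 : Type*) {𝔤 : Type*} [Field 𝕜] [AddCommGroup 𝔤] [Module 𝕜 𝔤]
    [Bracket 𝔤 𝔤] (α : BCHTree → ℚ) (x y : 𝔤) (n : ℕ) : 𝔤 :=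
  ∑ T ∈ BCHTree.withLeaves n, (α T : 𝕜) • T.eval x y

/-! By Artin's theorem, two elements of an alternative algebra generate an associative subalgebra,
so the BCH identity of the free algebra can be evaluated at `ι x`, `ι y`; this gives the formula for
`ι (Z_n)`.

For convergence, `Z_n` is not estimated tree by tree but through Dynkin's form. Let a letter `x` act
on `𝔤 × 𝕜` by `(v, c) ↦ (⁅x, v⁆ + c • x, 0)`. In the free algebra, a bracket with `n` leaves then
sends `(0, 1)` to `n` times itself (`dynkinRep_eval`). Evaluating in `A` and using that `ι` is
injective, `n • Z_n(x, y)` is the value at `(0, 1)` of the degree `n` part of `log(exp X exp Y)` for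
the two operators of `x` and `y` (`smul_bchTerm`). These have norms at most `p = B‖x‖` and `q =
B‖y‖` in a weighted seminorm, so the series is dominated by `∑ k, (exp (p + q) - 1) ^ k`, which is
finite for `p + q < log 2`. As `K ≥ 1`, the hypotheses give `p + q < 1 / 2`. -/

section Artin

variable {A : Type*} [NonAssocRing A]

/-! ### Skew-symmetry of the associator. -/

section Alternating

variable [AlternativeRing A]

theorem associator_self_left (a b : A) : associator a a b = 0 :=
  sub_eq_zero.2 (AlternativeRing.left_alt a b)

theorem associator_self_right (a b : A) : associator b a a = 0 :=
  sub_eq_zero.2 (AlternativeRing.right_alt a b)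

theorem associator_swap_left (a b c : A) : associator a b c = -associator b a c := by
  have h := associator_self_left (a + b) c
  have ha := associator_self_left a c
  have hb := associator_self_left b c
  simp only [← AddMonoidHom.associator_apply, map_add, AddMonoidHom.add_apply] at h ha hb ⊢
  rw [ha, hb] at h
  exact eq_neg_of_add_eq_zero_right (by simpa using h)

theorem associator_swap_right (a b c : A) : associator a b c = -associator a c b := by
  have h := associator_self_right (b + c) a
  have hb := associator_self_right b a
  have hc := associator_self_right c a
  simp only [← AddMonoidHom.associator_apply, map_add, AddMonoidHom.add_apply] at h hb hc ⊢
  rw [hb, hc] at h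
  exact eq_neg_of_add_eq_zero_right (by simpa using h)

theorem associator_rotate (a b c : A) : associator a b c = associator b c a := by
  rw [associator_swap_left, associator_swap_right, neg_neg]

theorem associator_self_outer (a b : A) : associator a b a = 0 := by
  rw [associator_swap_right, associator_self_left, neg_zero]

end Alternating

/-! ### Artin's theorem, by induction on word length. -/

/-- The right-nested product of a word. -/
def nestedProd {X : Type*} (f : X → A) : List X → A
  | [] => 1
  | i :: w => f i * nestedProd f w

theorem nestedProd_singleton {X : Type*} (f : X → A) (i : X) : nestedProd f [i] = f i := by
  simp [nestedProd]

/-- The associator of the right-nested products of three words. -/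
def wordAssociator {X : Type*} (f : X → A) (u v w : List X) : A :=
  associator (nestedProd f u) (nestedProd f v) (nestedProd f w)

/-- Right-nested products are multiplicative on words of total length less than `N`. -/
def NestedProdMulBelow {X : Type*} (f : X → A) (N : ℕ) : Prop :=
  ∀ u v : List X, u.length + v.length < N →
    nestedProd f (u ++ v) = nestedProd f u * nestedProd f v

namespace NestedProdMulBelow

section

variable {X : Type*} {f : X → A} {N : ℕ}

theorem wordAssociator_eq_zero (H : NestedProdMulBelow f N) {u v w : List X}
    (h : u.length + v.length + w.length < N) : wordAssociator f u v w = 0 := by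
  rw [wordAssociator, associator_apply, ← H u v (by omega), ← H v w (by omega),
    ← H (u ++ v) w (by simpa using h), ← H u (v ++ w) (by simpa [add_assoc] using h),
    List.append_assoc, sub_self]

/-- This is the pentagon identity of associators: its two remaining terms contain associators of
total length below `N`, which vanish by `H`. -/
theorem cocycle (H : NestedProdMulBelow f N) {p q r s : List X}
    (hp : p ≠ []) (hq : q ≠ []) (hr : r ≠ []) (hs : s ≠ [])
    (h : p.length + q.length + r.length + s.length = N) :
    wordAssociator f (p ++ q) r s - wordAssociator f p (q ++ r) s
      + wordAssociator f p q (r ++ s) = 0 := by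
  have hp' := List.length_pos_of_ne_nil hp
  have hq' := List.length_pos_of_ne_nil hq
  have hr' := List.length_pos_of_ne_nil hr
  have hs' := List.length_pos_of_ne_nil hs
  have h1 := H.wordAssociator_eq_zero (u := q) (v := r) (w := s) (by omega)
  have h2 := H.wordAssociator_eq_zero (u := p) (v := q) (w := r) (by omega)
  have hc := associator_cocycle (nestedProd f p) (nestedProd f q) (nestedProd f r) (nestedProd f s)
  unfold wordAssociator at *
  rw [h1, h2, ← H p q (by omega), ← H q r (by omega), ← H r s (by omega)] at hc
  rw [← neg_eq_zero, ← hc]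
  simp only [mul_zero, zero_mul]
  abel

variable [AlternativeRing A]

theorem swap_last (p q r s : List X) :
    wordAssociator f (p ++ q) r s = -wordAssociator f (p ++ q) s r :=
  associator_swap_right _ _ _

/-- Add the cocycle relations of `(p, q, r, s)` and `(q, r, s, p)`; after rotation the other terms
cancel. This 4-cycle and `swap_last` generate all permutations, so `wordAssociator f (p ++ q) r s`
is alternating in the four words. -/
theorem cyclic (H : NestedProdMulBelow f N) {p q r s : List X}
    (hp : p ≠ []) (hq : q ≠ []) (hr : r ≠ []) (hs : s ≠ [])
    (h : p.length + q.length + r.length + s.length = N) :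
    wordAssociator f (p ++ q) r s = -wordAssociator f (s ++ p) q r := by
  have h1 := H.cocycle hp hq hr hs h
  have e1 : wordAssociator f p (q ++ r) s = wordAssociator f s p (q ++ r) :=
    (associator_rotate _ _ _).symm
  have e2 : wordAssociator f p q (r ++ s) = wordAssociator f (r ++ s) p q :=
    (associator_rotate _ _ _).symm
  rw [e1, e2] at h1
  rw [← sub_eq_zero, sub_neg_eq_add]
  have e3 : wordAssociator f (q ++ r) s p = wordAssociator f s p (q ++ r) :=
    associator_rotate _ _ _
  have h2 := H.cocycle hq hr hs hp (by omega)
  have e4 : wordAssociator f q (r ++ s) p = wordAssociator f (r ++ s) p q :=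
    associator_rotate _ _ _
  have e5 : wordAssociator f q r (s ++ p) = wordAssociator f (s ++ p) q r :=
    (associator_rotate _ _ _).symm
  rw [e3, e4, e5] at h2
  have := congrArg₂ (· + ·) h1 h2
  simp only [add_zero] at this
  rw [← this]
  abel

theorem swap_middle (H : NestedProdMulBelow f N) {p q r s : List X}
    (hp : p ≠ []) (hq : q ≠ []) (hr : r ≠ []) (hs : s ≠ [])
    (h : p.length + q.length + r.length + s.length = N) :
    wordAssociator f (p ++ q) r s = -wordAssociator f (p ++ r) q s := by
  rw [H.cyclic hp hq hr hs h, swap_last, H.cyclic hp hr hq hs (by omega)]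

theorem swap_first (H : NestedProdMulBelow f N) {p q r s : List X}
    (hp : p ≠ []) (hq : q ≠ []) (hr : r ≠ []) (hs : s ≠ [])
    (h : p.length + q.length + r.length + s.length = N) :
    wordAssociator f (p ++ q) r s = -wordAssociator f (q ++ p) r s := by
  rw [H.cyclic hp hq hr hs h, H.swap_middle hs hp hq hr (by omega),
    H.cyclic hq hp hr hs (by omega)]

theorem rotate_first (H : NestedProdMulBelow f N) {p q r s : List X}
    (hp : p ≠ []) (hq : q ≠ []) (hr : r ≠ []) (hs : s ≠ [])
    (h : p.length + q.length + r.length + s.length = N) :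
    wordAssociator f (p ++ q) r s = wordAssociator f (q ++ r) p s := by
  rw [H.swap_first hp hq hr hs h, H.swap_middle hq hp hr hs (by omega), neg_neg]

end

section TwoLetters

variable [AlternativeRing A] {f : Bool → A} {N : ℕ}

theorem wordAssociator_letter_letter (H : NestedProdMulBelow f N) {w : List Bool} (i j : Bool)
    (hw : w ≠ []) (h : w.length + 2 = N) : wordAssociator f w [i] [j] = 0 := by
  obtain ⟨l, z, rfl⟩ := List.exists_cons_of_ne_nil hw
  rcases eq_or_ne i j with rfl | hij
  · exact associator_self_right _ _
  -- Having only two letters matters here: the first letter of `w` must repeat `i` or `j`, and an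
  -- even permutation moves it next to its copy.
  have hl : l = i ∨ l = j := by
    revert hij; cases l <;> cases i <;> cases j <;> simp
  rcases eq_or_ne z [] with rfl | hz
  · rcases hl with rfl | rfl
    · exact associator_self_left _ _
    · exact associator_self_outer _ _
  have hlen : [l].length + z.length + 2 = N := by simp at h ⊢; omega
  change wordAssociator f ([l] ++ z) [i] [j] = 0
  rcases hl with rfl | rfl
  · rw [swap_last, H.rotate_first (by simp) hz (by simp) (by simp) (by simp at hlen ⊢; omega),
      wordAssociator, associator_self_right, neg_zero]
  · rw [H.rotate_first (by simp) hz (by simp) (by simp) (by simp at hlen ⊢; omega),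
      wordAssociator, associator_self_right]

/-- Rotating the tail of `r` into the first slot leaves two single letters in the others. -/
theorem wordAssociator_letter (H : NestedProdMulBelow f N) {w r : List Bool} (i : Bool)
    (hw : w ≠ []) (hr : r ≠ []) (h : w.length + 1 + r.length = N) :
    wordAssociator f w [i] r = 0 := by
  obtain ⟨j, r', rfl⟩ := List.exists_cons_of_ne_nil hr
  rcases eq_or_ne r' [] with rfl | hr'
  · exact H.wordAssociator_letter_letter i j hw (by simpa using h)
  rw [wordAssociator, ← associator_rotate]
  change wordAssociator f ([j] ++ r') w [i] = 0
  rw [H.rotate_first (by simp) hr' hw (by simp) (by simp at h ⊢; omega)]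
  exact H.wordAssociator_letter_letter _ _ (by simp [hw]) (by simp at h ⊢; omega)

theorem wordAssociator_eq_zero_of_length_eq (H : NestedProdMulBelow f N) {u v w : List Bool}
    (hu : u ≠ []) (hv : v ≠ []) (hw : w ≠ []) (h : u.length + v.length + w.length = N) :
    wordAssociator f u v w = 0 := by
  obtain ⟨i, w', rfl⟩ := List.exists_cons_of_ne_nil hw
  rcases eq_or_ne w' [] with rfl | hw'
  · rw [wordAssociator, associator_swap_right, neg_eq_zero]
    exact H.wordAssociator_letter i hu hv (by simp at h ⊢; omega)
  rw [wordAssociator, ← associator_rotate]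
  change wordAssociator f ([i] ++ w') u v = 0
  rw [H.rotate_first (by simp) hw' hu hv (by simp at h ⊢; omega)]
  exact H.wordAssociator_letter _ (by simp [hw']) hv (by simp at h ⊢; omega)

end TwoLetters

end NestedProdMulBelow

variable [AlternativeRing A]

theorem nestedProdMulBelow (f : Bool → A) (N : ℕ) : NestedProdMulBelow f N := by
  induction N with
  | zero => intro u v h; omega
  | succ N H =>
    intro u v h
    rcases Nat.lt_succ_iff_lt_or_eq.1 h with h | h
    · exact H u v h
    rcases eq_or_ne v [] with rfl | hv
    · simp [nestedProd]
    cases u with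
    | nil => simp [nestedProd]
    | cons i u =>
      rcases eq_or_ne u [] with rfl | hu
      · simp [nestedProd]
      -- Moving the first letter across the product costs exactly this associator, of total length
      -- `N`.
      have h0 := H.wordAssociator_eq_zero_of_length_eq (u := [i]) (by simp) hu hv
        (by simp at h ⊢; omega)
      rw [wordAssociator, nestedProd_singleton, associator_apply, sub_eq_zero,
        ← H u v (by simp at h; omega)] at h0
      exact h0.symm

/-- **Artin's theorem**: any two elements of an alternative ring generate an associative subring,
in the form that the right-nested products of words in two elements are multiplicative. -/
theorem nestedProd_append (f : Bool → A) (u v : List Bool) :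
    nestedProd f (u ++ v) = nestedProd f u * nestedProd f v :=
  nestedProdMulBelow f _ u v (Nat.lt_succ_self _)

end Artin

/-! ### Evaluation of the free algebra at two elements. -/

section EvalTwo

variable (𝕜 : Type*) {A : Type*} [Field 𝕜] [NonAssocRing A] [Module 𝕜 A] [IsScalarTower 𝕜 A A]
  [SMulCommClass 𝕜 A A] [AlternativeRing A]

/-- The evaluation of noncommutative polynomials at two elements of an alternative algebra. -/
noncomputable def alternativeEval (f : Bool → A) : FreeAlgebra 𝕜 Bool →ₙₐ[𝕜] A :=
  (MonoidAlgebra.liftMagma 𝕜 (M := FreeMonoid Bool)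
    { toFun := fun w => nestedProd f w.toList
      map_mul' := fun u v => nestedProd_append f u.toList v.toList }).comp
    (FreeAlgebra.equivMonoidAlgebraFreeMonoid (R := 𝕜) (X := Bool)).toAlgHom.toNonUnitalAlgHom

theorem alternativeEval_one (f : Bool → A) : alternativeEval 𝕜 f 1 = 1 := by
  change MonoidAlgebra.liftMagma 𝕜 _ (FreeAlgebra.equivMonoidAlgebraFreeMonoid 1) = 1
  simp only [map_one, MonoidAlgebra.one_def, MonoidAlgebra.liftMagma_apply_apply]
  simp
  rfl

theorem alternativeEval_ι (f : Bool → A) (i : Bool) :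
    alternativeEval 𝕜 f (FreeAlgebra.ι 𝕜 i) = f i := by
  change MonoidAlgebra.liftMagma 𝕜 _
    (FreeAlgebra.equivMonoidAlgebraFreeMonoid (FreeAlgebra.ι 𝕜 i)) = f i
  simp only [FreeAlgebra.equivMonoidAlgebraFreeMonoid, AlgEquiv.ofAlgHom_apply,
    FreeAlgebra.lift_ι_apply, MonoidAlgebra.liftMagma_apply_apply]
  simp
  exact nestedProd_singleton f i

end EvalTwo

/-! ### Naturality of the components of `log(exp a exp b)`, allowing a change of scalars. -/

section Transfer

variable {R R' A A' : Type*} [Field R] [Field R'] [NonAssocRing A] [NonAssocRing A'] [Module R A]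
  [Module R' A'] (σ : R →+* R') (ψ : A →+* A') (hψ : ∀ (r : R) (a : A), ψ (r • a) = σ r • ψ a)

theorem map_nestedPow (a : A) (n : ℕ) : ψ (nestedPow a n) = nestedPow (ψ a) n := by
  induction n with
  | zero => simp [nestedPow]
  | succ n ih => simp [nestedPow, ih]

include hψ

theorem map_expMulExpComponent (a b : A) (n : ℕ) :
    ψ (expMulExpComponent R a b n) = expMulExpComponent R' (ψ a) (ψ b) n := by
  simp [expMulExpComponent, hψ, map_nestedPow]

theorem map_expMulExpSubOnePowComponent (a b : A) (k n : ℕ) :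
    ψ (expMulExpSubOnePowComponent R a b k n) =
      expMulExpSubOnePowComponent R' (ψ a) (ψ b) k n := by
  induction k generalizing n with
  | zero => simp [expMulExpSubOnePowComponent, apply_ite ψ]
  | succ k ih =>
    simp [expMulExpSubOnePowComponent, apply_ite ψ, ih, map_expMulExpComponent σ ψ hψ]

theorem map_logExpMulExpComponent (a b : A) (n : ℕ) :
    ψ (logExpMulExpComponent R a b n) = logExpMulExpComponent R' (ψ a) (ψ b) n := by
  simp [logExpMulExpComponent, hψ, map_expMulExpSubOnePowComponent σ ψ hψ]

end Transfer

theorem BCHTree.map_eval {L L' F : Type*} [Bracket L L] [Bracket L' L'] [FunLike F L L'] (ψ : F)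
    (hψ : ∀ a b : L, ψ ⁅a, b⁆ = ⁅ψ a, ψ b⁆) (a b : L) (T : BCHTree) :
    ψ (T.eval a b) = T.eval (ψ a) (ψ b) := by
  induction T with
  | x => rfl
  | y => rfl
  | node l r hl hr => simp [eval, hψ, hl, hr]

/-- Baker-Campbell-Hausdorff coefficients compute the series in the free algebra over any field of
characteristic zero. -/
theorem IsBCHCoefficients.bchTerm_freeAlgebra {α : BCHTree → ℚ} (hα : IsBCHCoefficients α)
    (𝕜 : Type*) [Field 𝕜] [CharZero 𝕜] (n : ℕ) :
    bchTerm 𝕜 α (FreeAlgebra.ι 𝕜 false) (FreeAlgebra.ι 𝕜 true) n =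
      logExpMulExpComponent 𝕜 (FreeAlgebra.ι 𝕜 false) (FreeAlgebra.ι 𝕜 true) n := by
  let ψ : FreeAlgebra ℚ Bool →ₐ[ℚ] FreeAlgebra 𝕜 Bool := FreeAlgebra.lift ℚ (FreeAlgebra.ι 𝕜)
  have hψ : ∀ (q : ℚ) (a : FreeAlgebra ℚ Bool), ψ (q • a) = (algebraMap ℚ 𝕜 q) • ψ a := by
    intro q a
    rw [map_smul, algebraMap_smul]
  have hι : ∀ i, ψ (FreeAlgebra.ι ℚ i) = FreeAlgebra.ι 𝕜 i := FreeAlgebra.lift_ι_apply _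
  have h := congrArg ψ (hα n)
  rw [map_sum] at h
  have h' := map_logExpMulExpComponent (algebraMap ℚ 𝕜) (ψ : FreeAlgebra ℚ Bool →+* FreeAlgebra 𝕜 Bool) hψ
    (FreeAlgebra.ι ℚ false) (FreeAlgebra.ι ℚ true) n
  simp only [RingHom.coe_coe, hι] at h'
  rw [← h', ← h, bchTerm]
  refine Finset.sum_congr rfl fun T _ => ?_
  rw [hψ, BCHTree.map_eval ψ (by intro a b; simp [Ring.lie_def]), hι, hι]
  simp

/-! ### The BCH identity inside the alternative algebra. -/

section Embedding

variable {𝕜 𝔤 A : Type*} [Field 𝕜] [AddCommGroup 𝔤] [Module 𝕜 𝔤] [Bracket 𝔤 𝔤]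
  [NonAssocRing A] [Module 𝕜 A] [IsScalarTower 𝕜 A A] [SMulCommClass 𝕜 A A] [AlternativeRing A]
  {ι : 𝔤 →ₗ[𝕜] A}

theorem IsCommutatorEmbedding.map_bchTerm (hι : IsCommutatorEmbedding ι) (α : BCHTree → ℚ)
    (f : Bool → 𝔤) (n : ℕ) :
    ι (bchTerm 𝕜 α (f false) (f true) n) = alternativeEval 𝕜 (ι ∘ f)
      (bchTerm 𝕜 α (FreeAlgebra.ι 𝕜 false) (FreeAlgebra.ι 𝕜 true) n) := by
  simp only [bchTerm, map_sum, map_smul]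
  refine Finset.sum_congr rfl fun T hT => ?_
  clear hT
  congr 1
  induction T with
  | x => simp [BCHTree.eval, alternativeEval_ι]
  | y => simp [BCHTree.eval, alternativeEval_ι]
  | node l r hl hr => simp [BCHTree.eval, hι.map_bracket, hl, hr, Ring.lie_def]

theorem IsBCHCoefficients.map_bchTerm_eq [CharZero 𝕜] {α : BCHTree → ℚ} (hα : IsBCHCoefficients α)
    (hι : IsCommutatorEmbedding ι) (x y : 𝔤) (n : ℕ) :
    ι (bchTerm 𝕜 α x y n) = logExpMulExpComponent 𝕜 (ι x) (ι y) n := by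
  let f : Bool → 𝔤 := fun i => bif i then y else x
  let ψ : FreeAlgebra 𝕜 Bool →+* A :=
    { alternativeEval 𝕜 (ι ∘ f) with
      map_one' := alternativeEval_one 𝕜 _
      map_zero' := map_zero (alternativeEval 𝕜 (ι ∘ f))
      map_add' := map_add (alternativeEval 𝕜 (ι ∘ f)) }
  have h := map_logExpMulExpComponent (RingHom.id 𝕜) ψ
    (fun r a => map_smul (alternativeEval 𝕜 (ι ∘ f)) r a)
    (FreeAlgebra.ι 𝕜 false) (FreeAlgebra.ι 𝕜 true) n
  have hf : ∀ i, ψ (FreeAlgebra.ι 𝕜 i) = ι (f i) := alternativeEval_ι 𝕜 (ι ∘ f)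
  rw [hf, hf, ← hα.bchTerm_freeAlgebra] at h
  exact (hι.map_bchTerm α f n).trans h

end Embedding

/-! ### The Dynkin-Specht-Wever identity. -/

section Dynkin

/-- The operator `(v, c) ↦ (D v + c • x, 0)` on `V × 𝕜`. -/
def affineEnd {𝕜 V : Type*} [Field 𝕜] [AddCommGroup V] [Module 𝕜 V] (D : V →ₗ[𝕜] V) (x : V) :
    Module.End 𝕜 (V × 𝕜) :=
  (D.comp (LinearMap.fst 𝕜 V 𝕜) + (LinearMap.snd 𝕜 V 𝕜).smulRight x).prod 0

theorem affineEnd_apply {𝕜 V : Type*} [Field 𝕜] [AddCommGroup V] [Module 𝕜 V] (D : V →ₗ[𝕜] V)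
    (x : V) (p : V × 𝕜) : affineEnd D x p = (D p.1 + p.2 • x, 0) := rfl

variable (𝕜 : Type*) [Field 𝕜]

/-- The representation of the free algebra `F` on `F × 𝕜` sending a letter `i` to
`(v, c) ↦ (⁅i, v⁆ + c • i, 0)`. -/
noncomputable def dynkinRep : FreeAlgebra 𝕜 Bool →ₐ[𝕜] Module.End 𝕜 (FreeAlgebra 𝕜 Bool × 𝕜) :=
  FreeAlgebra.lift 𝕜 fun i => affineEnd (LinearMap.mulLeft 𝕜 (FreeAlgebra.ι 𝕜 i) -
    LinearMap.mulRight 𝕜 (FreeAlgebra.ι 𝕜 i)) (FreeAlgebra.ι 𝕜 i)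

/-- The Dynkin-Specht-Wever identity for iterated brackets. -/
theorem dynkinRep_eval (T : BCHTree) (p : FreeAlgebra 𝕜 Bool × 𝕜) :
    dynkinRep 𝕜 (T.eval (FreeAlgebra.ι 𝕜 false) (FreeAlgebra.ι 𝕜 true)) p =
      (⁅T.eval (FreeAlgebra.ι 𝕜 false) (FreeAlgebra.ι 𝕜 true), p.1⁆ +
        (p.2 * T.leaves) • T.eval (FreeAlgebra.ι 𝕜 false) (FreeAlgebra.ι 𝕜 true), 0) := by
  induction T generalizing p with
  | x => simp [BCHTree.eval, BCHTree.leaves, dynkinRep, affineEnd_apply, Ring.lie_def]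
  | y => simp [BCHTree.eval, BCHTree.leaves, dynkinRep, affineEnd_apply, Ring.lie_def]
  | node l r hl hr =>
    generalize hP : l.eval (FreeAlgebra.ι 𝕜 false) (FreeAlgebra.ι 𝕜 true) = P at *
    generalize hQ : r.eval (FreeAlgebra.ι 𝕜 false) (FreeAlgebra.ι 𝕜 true) = Q at *
    simp only [BCHTree.eval, BCHTree.leaves, hP, hQ]
    rw [Ring.lie_def, map_sub, map_mul, map_mul, LinearMap.sub_apply, Module.End.mul_apply,
      Module.End.mul_apply, hl, hr, hl, hr]
    -- The leaf counts add because `⁅P, m • Q⁆ - ⁅Q, l • P⁆ = (l + m) • ⁅P, Q⁆`; the rest is the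
    -- Jacobi identity.
    ext
    · simp only [Ring.lie_def, Prod.fst_sub, mul_add, add_mul, mul_sub, sub_mul, add_smul, smul_sub,
        mul_smul_comm, smul_mul_assoc, zero_mul, zero_smul, add_zero, Nat.cast_add, mul_assoc]
      abel
    · simp

theorem dynkinRep_bchTerm (α : BCHTree → ℚ) (n : ℕ) :
    (dynkinRep 𝕜 (bchTerm 𝕜 α (FreeAlgebra.ι 𝕜 false) (FreeAlgebra.ι 𝕜 true) n) (0, 1)).1 =
      (n : 𝕜) • bchTerm 𝕜 α (FreeAlgebra.ι 𝕜 false) (FreeAlgebra.ι 𝕜 true) n := by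
  simp only [bchTerm, map_sum, map_smul, LinearMap.sum_apply, Prod.fst_sum, Finset.smul_sum]
  refine Finset.sum_congr rfl fun T hT => ?_
  rw [LinearMap.smul_apply, dynkinRep_eval, BCHTree.mem_withLeaves.1 hT, smul_comm]
  simp [Ring.lie_def]

end Dynkin

/-! ### Dynkin's form on the Malcev algebra. -/

section MalcevAffine

variable (𝕜 : Type*) {𝔤 : Type*} [Field 𝕜] [AddCommGroup 𝔤] [Module 𝕜 𝔤] [Bracket 𝔤 𝔤]
  [MalcevAlgebra 𝕜 𝔤]

/-- The left multiplication `v ↦ ⁅x, v⁆` of a Malcev algebra. -/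
def malcevAd (x : 𝔤) : 𝔤 →ₗ[𝕜] 𝔤 where
  toFun v := ⁅x, v⁆
  map_add' u v := by
    rw [MalcevAlgebra.skew 𝕜, MalcevAlgebra.add_bracket 𝕜, neg_add, ← MalcevAlgebra.skew 𝕜,
      ← MalcevAlgebra.skew 𝕜]
  map_smul' c v := by
    rw [MalcevAlgebra.skew 𝕜, MalcevAlgebra.smul_bracket, ← smul_neg, ← MalcevAlgebra.skew 𝕜,
      RingHom.id_apply]

/-- The operator `(v, c) ↦ (⁅x, v⁆ + c • x, 0)` on `𝔤 × 𝕜`. -/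
def malcevAffine (x : 𝔤) : Module.End 𝕜 (𝔤 × 𝕜) := affineEnd (malcevAd 𝕜 x) x

variable {A : Type*} [NonAssocRing A] [Module 𝕜 A] [IsScalarTower 𝕜 A A] [SMulCommClass 𝕜 A A]
  [AlternativeRing A] {ι : 𝔤 →ₗ[𝕜] A}

/-- The adjoint maps of `𝔤` need not represent the bracket, but freeness only asks for compatibility
on single letters, where `ι` turns `⁅x, v⁆` into a commutator. -/
theorem IsCommutatorEmbedding.alternativeEval_dynkinRep (hι : IsCommutatorEmbedding ι)
    (f : Bool → 𝔤) (w : FreeAlgebra 𝕜 Bool) (P : FreeAlgebra 𝕜 Bool × 𝕜) (p : 𝔤 × 𝕜)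
    (h1 : alternativeEval 𝕜 (ι ∘ f) P.1 = ι p.1) (h2 : P.2 = p.2) :
    alternativeEval 𝕜 (ι ∘ f) (dynkinRep 𝕜 w P).1 =
        ι (FreeAlgebra.lift 𝕜 (fun i => malcevAffine 𝕜 (f i)) w p).1 ∧
      (dynkinRep 𝕜 w P).2 = (FreeAlgebra.lift 𝕜 (fun i => malcevAffine 𝕜 (f i)) w p).2 := by
  induction w using FreeAlgebra.induction generalizing P p with
  | grade0 r => simp [Module.algebraMap_end_apply, h1, h2]
  | grade1 i =>
    simp [dynkinRep, malcevAffine, affineEnd_apply, malcevAd, alternativeEval_ι, h1, h2,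
      hι.map_bracket]
  | mul u v hu hv =>
    obtain ⟨h1, h2⟩ := hv P p h1 h2
    simpa using hu _ _ h1 h2
  | add u v hu hv =>
    obtain ⟨a1, a2⟩ := hu P p h1 h2
    obtain ⟨b1, b2⟩ := hv P p h1 h2
    simp [a1, a2, b1, b2]

/-- Dynkin's form of the Baker-Campbell-Hausdorff series. -/
theorem IsBCHCoefficients.smul_bchTerm [CharZero 𝕜] {α : BCHTree → ℚ} (hα : IsBCHCoefficients α)
    (hι : IsCommutatorEmbedding ι) (x y : 𝔤) (n : ℕ) :
    (n : 𝕜) • bchTerm 𝕜 α x y n =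
      (logExpMulExpComponent 𝕜 (malcevAffine 𝕜 x) (malcevAffine 𝕜 y) n (0, 1)).1 := by
  let f : Bool → 𝔤 := fun i => bif i then y else x
  apply hι.injective
  let ψ := FreeAlgebra.lift 𝕜 (fun i => malcevAffine 𝕜 (f i))
  have hψ : ∀ i, ψ (FreeAlgebra.ι 𝕜 i) = malcevAffine 𝕜 (f i) := FreeAlgebra.lift_ι_apply _
  have h := map_logExpMulExpComponent (RingHom.id 𝕜)
    (ψ : FreeAlgebra 𝕜 Bool →+* Module.End 𝕜 (𝔤 × 𝕜))
    (fun r a => map_smul ψ r a) (FreeAlgebra.ι 𝕜 false) (FreeAlgebra.ι 𝕜 true) n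
  simp only [RingHom.coe_coe, hψ] at h
  change ι _ = ι (logExpMulExpComponent 𝕜 (malcevAffine 𝕜 (f false)) (malcevAffine 𝕜 (f true)) n
    (0, 1)).1
  rw [← h, ← (hι.alternativeEval_dynkinRep 𝕜 f _ (0, 1) (0, 1) (by simp) rfl).1,
    ← hα.bchTerm_freeAlgebra, dynkinRep_bchTerm, map_smul, map_smul, ← hι.map_bchTerm]
  rfl

end MalcevAffine

/-! ### Operator bounds by the same series in real numbers. -/

section OpBound

variable {𝕜 V : Type*} [RCLike 𝕜] [AddCommGroup V] [Module 𝕜 V] {N : Seminorm 𝕜 V}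

/-- The linear endomorphism `S` is bounded by `c` with respect to the seminorm `N`. -/
def OpBound (N : Seminorm 𝕜 V) (S : Module.End 𝕜 V) (c : ℝ) : Prop := ∀ v, N (S v) ≤ c * N v

namespace OpBound

theorem zero : OpBound N 0 0 := fun v => by simp

theorem one : OpBound N 1 1 := fun v => by simp

theorem smul (r : 𝕜) {S : Module.End 𝕜 V} {c : ℝ} (h : OpBound N S c) :
    OpBound N (r • S) (‖r‖ * c) := fun v => by
  rw [LinearMap.smul_apply, map_smul_eq_mul, mul_assoc]
  exact mul_le_mul_of_nonneg_left (h v) (norm_nonneg r)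

theorem mul {S T : Module.End 𝕜 V} {c d : ℝ} (hS : OpBound N S c) (hT : OpBound N T d)
    (hc : 0 ≤ c) : OpBound N (S * T) (c * d) := fun v => by
  rw [Module.End.mul_apply, mul_assoc]
  exact (hS _).trans (mul_le_mul_of_nonneg_left (hT v) hc)

theorem sum {ι : Type*} (s : Finset ι) {S : ι → Module.End 𝕜 V} {c : ι → ℝ}
    (h : ∀ i ∈ s, OpBound N (S i) (c i)) : OpBound N (∑ i ∈ s, S i) (∑ i ∈ s, c i) := fun v => by
  rw [LinearMap.sum_apply, Finset.sum_mul]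
  exact (Finset.le_sum_of_subadditive N (map_zero N).le (map_add_le_add N) s _).trans (Finset.sum_le_sum fun i hi => h i hi v)

theorem mono {S : Module.End 𝕜 V} {c d : ℝ} (h : OpBound N S c) (hcd : c ≤ d) :
    OpBound N S d := fun v => (h v).trans (mul_le_mul_of_nonneg_right hcd (apply_nonneg N v))

end OpBound

theorem nestedPow_nonneg {p : ℝ} (hp : 0 ≤ p) (n : ℕ) : 0 ≤ nestedPow p n := by
  induction n with
  | zero => exact zero_le_one
  | succ n ih => exact mul_nonneg hp ih

theorem expMulExpComponent_nonneg {p q : ℝ} (hp : 0 ≤ p) (hq : 0 ≤ q) (n : ℕ) :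
    0 ≤ expMulExpComponent ℝ p q n := by
  refine Finset.sum_nonneg fun i _ => ?_
  have := nestedPow_nonneg hp i.1
  have := nestedPow_nonneg hq i.2
  simp only [smul_eq_mul]
  positivity

theorem expMulExpSubOnePowComponent_nonneg {p q : ℝ} (hp : 0 ≤ p) (hq : 0 ≤ q) (k n : ℕ) :
    0 ≤ expMulExpSubOnePowComponent ℝ p q k n := by
  induction k generalizing n with
  | zero =>
    simp only [expMulExpSubOnePowComponent]
    split_ifs <;> simp
  | succ k ih =>
    refine Finset.sum_nonneg fun i _ => mul_nonneg ?_ (ih _)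
    split_ifs
    · exact le_rfl
    · exact expMulExpComponent_nonneg hp hq _

namespace OpBound

variable {X Y : Module.End 𝕜 V} {p q : ℝ}

theorem nestedPow (hX : OpBound N X p) (hp : 0 ≤ p) (n : ℕ) :
    OpBound N (_root_.nestedPow X n) (_root_.nestedPow p n) := by
  induction n with
  | zero => exact one
  | succ n ih => exact hX.mul ih hp

theorem expMulExpComponent (hX : OpBound N X p) (hY : OpBound N Y q) (hp : 0 ≤ p) (hq : 0 ≤ q)
    (n : ℕ) : OpBound N (_root_.expMulExpComponent 𝕜 X Y n)
      (_root_.expMulExpComponent ℝ p q n) := by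
  refine sum _ fun i _ => ?_
  have h1 := (hX.nestedPow hp i.1).smul ((i.1 ! : 𝕜)⁻¹)
  have h2 := (hY.nestedPow hq i.2).smul ((i.2 ! : 𝕜)⁻¹)
  have h := h1.mul h2 (mul_nonneg (norm_nonneg _) (nestedPow_nonneg hp _))
  simpa using h

theorem expMulExpSubOnePowComponent (hX : OpBound N X p) (hY : OpBound N Y q) (hp : 0 ≤ p)
    (hq : 0 ≤ q) (k n : ℕ) : OpBound N (_root_.expMulExpSubOnePowComponent 𝕜 X Y k n)
      (_root_.expMulExpSubOnePowComponent ℝ p q k n) := by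
  induction k generalizing n with
  | zero =>
    simp only [_root_.expMulExpSubOnePowComponent]
    split_ifs
    · exact one
    · exact zero
  | succ k ih =>
    refine sum _ fun i _ => ?_
    split_ifs
    · exact zero.mul (ih _) le_rfl
    · exact (hX.expMulExpComponent hY hp hq _).mul (ih _) (expMulExpComponent_nonneg hp hq _)

theorem logExpMulExpComponent (hX : OpBound N X p) (hY : OpBound N Y q) (hp : 0 ≤ p)
    (hq : 0 ≤ q) (n : ℕ) : OpBound N (_root_.logExpMulExpComponent 𝕜 X Y n)
      (∑ k ∈ Finset.Icc 1 n, _root_.expMulExpSubOnePowComponent ℝ p q k n) := by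
  refine sum _ fun k hk => ((hX.expMulExpSubOnePowComponent hY hp hq k n).smul _).mono ?_
  -- The coefficients `± 1 / k` are bounded by `1`, which leaves a geometric majorant.
  refine mul_le_of_le_one_left (expMulExpSubOnePowComponent_nonneg hp hq k n) ?_
  have hk1 : (1 : ℝ) ≤ k := by exact_mod_cast (Finset.mem_Icc.1 hk).1
  simpa using inv_le_one_of_one_le₀ hk1

end OpBound

end OpBound

/-! ### Summability of the real majorant. -/

section Majorant

theorem HasSum.mul_antidiagonal_of_nonneg {f g : ℕ → ℝ} {a b : ℝ} (hf : HasSum f a)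
    (hg : HasSum g b) (hf0 : ∀ n, 0 ≤ f n) (hg0 : ∀ n, 0 ≤ g n) :
    HasSum (fun n => ∑ i ∈ Finset.HasAntidiagonal.antidiagonal n, f i.1 * g i.2) (a * b) := by
  have hfg := hf.summable.mul_of_nonneg hg.summable hf0 hg0
  rw [← hf.tsum_eq, ← hg.tsum_eq,
    hf.summable.tsum_mul_tsum_eq_tsum_sum_antidiagonal hg.summable hfg]
  exact (summable_sum_mul_antidiagonal_of_summable_mul hfg).hasSum

theorem nestedPow_eq_pow (p : ℝ) (n : ℕ) : nestedPow p n = p ^ n := by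
  induction n with
  | zero => rfl
  | succ n ih => rw [nestedPow, ih, pow_succ']

theorem hasSum_inv_factorial_smul_nestedPow (p : ℝ) :
    HasSum (fun n : ℕ => ((n ! : ℝ)⁻¹ • nestedPow p n)) (Real.exp p) := by
  rw [Real.exp_eq_exp_ℝ]
  simpa only [nestedPow_eq_pow] using NormedSpace.exp_series_hasSum_exp' (𝕂 := ℝ) p

variable {p q : ℝ} (hp : 0 ≤ p) (hq : 0 ≤ q)

include hp hq

theorem hasSum_expMulExpComponent :
    HasSum (expMulExpComponent ℝ p q) (Real.exp p * Real.exp q) := by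
  have h := (hasSum_inv_factorial_smul_nestedPow p).mul_antidiagonal_of_nonneg
    (hasSum_inv_factorial_smul_nestedPow q)
    (fun n => smul_nonneg (by positivity) (nestedPow_nonneg hp n))
    (fun n => smul_nonneg (by positivity) (nestedPow_nonneg hq n))
  have e : expMulExpComponent ℝ p q = fun n => ∑ i ∈ Finset.HasAntidiagonal.antidiagonal n,
      ((i.1 ! : ℝ)⁻¹ • nestedPow p i.1) * ((i.2 ! : ℝ)⁻¹ • nestedPow q i.2) :=
    funext fun n => by rw [expMulExpComponent]
  rwa [e]

theorem hasSum_expMulExpSubOnePowComponent (k : ℕ) :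
    HasSum (expMulExpSubOnePowComponent ℝ p q k) ((Real.exp p * Real.exp q - 1) ^ k) := by
  induction k with
  | zero => simpa [expMulExpSubOnePowComponent] using hasSum_ite_eq (0 : ℕ) (1 : ℝ)
  | succ k ih =>
    rw [pow_succ']
    refine HasSum.mul_antidiagonal_of_nonneg (f := fun n =>
      if n = 0 then 0 else expMulExpComponent ℝ p q n) ?_ ih (fun n => ?_)
      (expMulExpSubOnePowComponent_nonneg hp hq k)
    · have h := (hasSum_expMulExpComponent hp hq).sub (hasSum_ite_eq (0 : ℕ) (1 : ℝ))
      refine (funext fun n => ?_ : _ = fun n => _) ▸ h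
      rcases eq_or_ne n 0 with rfl | hn
      · simp [expMulExpComponent, nestedPow]
      · simp [hn]
    · split_ifs
      · exact le_rfl
      · exact expMulExpComponent_nonneg hp hq n

theorem summable_sum_expMulExpSubOnePowComponent (h : Real.exp p * Real.exp q < 2) :
    Summable fun n : ℕ => ∑ k ∈ Finset.Icc 1 n, expMulExpSubOnePowComponent ℝ p q k n := by
  have h1 : 1 ≤ Real.exp p * Real.exp q :=
    one_le_mul_of_one_le_of_one_le (Real.one_le_exp hp) (Real.one_le_exp hq)
  have h0 := expMulExpSubOnePowComponent_nonneg hp hq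
  have hs : Summable fun i : ℕ × ℕ => expMulExpSubOnePowComponent ℝ p q i.1 i.2 := by
    rw [summable_prod_of_nonneg fun i => h0 i.1 i.2]
    refine ⟨fun k => (hasSum_expMulExpSubOnePowComponent hp hq k).summable, ?_⟩
    simp only [(hasSum_expMulExpSubOnePowComponent hp hq _).tsum_eq]
    exact summable_geometric_of_lt_one (by linarith) (by linarith)
  -- Summing over `n` first gave a geometric series in `k`; nonnegativity allows the other order,
  -- and the terms `1 ≤ k ≤ n` are part of a full sum over `k`.
  have hs' := hs.prod_symm
  refine hs'.prod.of_nonneg_of_le (fun n => Finset.sum_nonneg fun k _ => h0 k n) fun n => ?_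
  exact (hs'.prod_factor n).sum_le_tsum _ fun k _ => h0 k n

end Majorant

/-! ### The weighted seminorm and absolute convergence. -/

section WeightedSeminorm

variable {𝕜 𝔤 : Type*} [RCLike 𝕜] [NormedAddCommGroup 𝔤] [NormedSpace 𝕜 𝔤]

variable (𝕜 𝔤) in
/-- The seminorm `(v, c) ↦ B * ‖v‖ + ‖c‖`. -/
noncomputable def affineSeminorm (B : NNReal) : Seminorm 𝕜 (𝔤 × 𝕜) :=
  B • (normSeminorm 𝕜 𝔤).comp (LinearMap.fst 𝕜 𝔤 𝕜) +
    (normSeminorm 𝕜 𝕜).comp (LinearMap.snd 𝕜 𝔤 𝕜)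

theorem affineSeminorm_apply (B : NNReal) (p : 𝔤 × 𝕜) :
    affineSeminorm 𝕜 𝔤 B p = B * ‖p.1‖ + ‖p.2‖ := rfl

variable [Bracket 𝔤 𝔤] [MalcevAlgebra 𝕜 𝔤]

/-- The weight `B` is chosen so that the linear and the affine part both scale by `B * ‖x‖`, while
`(0, 1)` has size `1`. -/
theorem opBound_malcevAffine (B : NNReal) (hbracket : ∀ x y : 𝔤, ‖⁅x, y⁆‖ ≤ B * ‖x‖ * ‖y‖)
    (x : 𝔤) : OpBound (affineSeminorm 𝕜 𝔤 B) (malcevAffine 𝕜 x) (B * ‖x‖) := fun p => by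
  simp only [affineSeminorm_apply, malcevAffine, affineEnd_apply, norm_zero, add_zero, mul_assoc]
  refine mul_le_mul_of_nonneg_left ?_ B.2
  calc ‖malcevAd 𝕜 x p.1 + p.2 • x‖ ≤ ‖⁅x, p.1⁆‖ + ‖p.2 • x‖ := norm_add_le _ _
    _ ≤ B * ‖x‖ * ‖p.1‖ + ‖p.2‖ * ‖x‖ := add_le_add (hbracket _ _) (norm_smul_le _ _)
    _ = ‖x‖ * (B * ‖p.1‖ + ‖p.2‖) := by ring

variable {A : Type*} [NonAssocRing A] [Module 𝕜 A] [IsScalarTower 𝕜 A A] [SMulCommClass 𝕜 A A]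
  [AlternativeRing A] {ι : 𝔤 →ₗ[𝕜] A}

/-- Absolute convergence of the Baker-Campbell-Hausdorff series of a special Malcev algebra with
a bounded bracket. -/
theorem IsBCHCoefficients.summable_norm_bchTerm {α : BCHTree → ℚ} (hα : IsBCHCoefficients α)
    (hι : IsCommutatorEmbedding ι) {B : NNReal} (hB : 0 < B)
    (hbracket : ∀ x y : 𝔤, ‖⁅x, y⁆‖ ≤ B * ‖x‖ * ‖y‖) (x y : 𝔤)
    (h : Real.exp (B * ‖x‖) * Real.exp (B * ‖y‖) < 2) :
    Summable fun n : ℕ => ‖bchTerm 𝕜 α x y n‖ := by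
  have hx : 0 ≤ B * ‖x‖ := by positivity
  have hy : 0 ≤ B * ‖y‖ := by positivity
  refine ((summable_sum_expMulExpSubOnePowComponent hx hy h).mul_left
    (B : ℝ)⁻¹).of_nonneg_of_le (fun n => norm_nonneg _) fun n => ?_
  rw [le_inv_mul_iff₀ (by exact_mod_cast hB)]
  rcases Nat.eq_zero_or_pos n with rfl | hn
  · have h0 : BCHTree.withLeaves 0 = ∅ := Finset.eq_empty_of_forall_notMem fun T hT =>
      T.leaves_pos.ne' (BCHTree.mem_withLeaves.1 hT)
    simp [bchTerm, h0]
  have hb := (opBound_malcevAffine (𝕜 := 𝕜) B hbracket x).logExpMulExpComponent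
    (opBound_malcevAffine B hbracket y) hx hy n (0, 1)
  rw [affineSeminorm_apply, affineSeminorm_apply, ← hα.smul_bchTerm 𝕜 hι, norm_smul] at hb
  simp only [RCLike.norm_natCast, norm_zero, mul_zero, norm_one, zero_add, mul_one] at hb
  have hn1 : (1 : ℝ) ≤ n := by exact_mod_cast hn
  refine le_trans ?_ ((le_add_of_nonneg_right (norm_nonneg _)).trans hb)
  exact mul_le_mul_of_nonneg_left (le_mul_of_one_le_left (norm_nonneg _) hn1) B.2

end WeightedSeminorm

theorem mainTheorem2 {𝕜 𝔤 A : Type*} [RCLike 𝕜]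
    [NormedAddCommGroup 𝔤] [NormedSpace 𝕜 𝔤] [CompleteSpace 𝔤]
    [Bracket 𝔤 𝔤] [MalcevAlgebra 𝕜 𝔤]
    [NonAssocRing A] [Module 𝕜 A] [IsScalarTower 𝕜 A A] [SMulCommClass 𝕜 A A]
    [AlternativeRing A]
    (ι : 𝔤 →ₗ[𝕜] A) (hι : IsCommutatorEmbedding ι)
    (B : ℝ) (hB : 0 ≤ B) (hbracket : ∀ x y : 𝔤, ‖⁅x, y⁆‖ ≤ B * ‖x‖ * ‖y‖)
    (α : BCHTree → ℚ) (hα : IsBCHCoefficients α)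
    (K : ℝ) (hK : 1 ≤ K) (hαK : ∀ T : BCHTree, |(α T : ℝ)| ≤ K)
    (x y : 𝔤) (hx : B * ‖x‖ < 1 / (4 * K)) (hy : B * ‖y‖ < 1 / (4 * K)) :
    (∀ n : ℕ, ι (bchTerm 𝕜 α x y n) = logExpMulExpComponent 𝕜 (ι x) (ι y) n) ∧
      Summable (fun n : ℕ => ‖bchTerm 𝕜 α x y n‖) := by
  refine ⟨hα.map_bchTerm_eq hι x y, ?_⟩
  have hK4 : 1 / (4 * K) ≤ 1 / 4 := one_div_le_one_div_of_le (by norm_num) (by linarith)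
  have hlim : ∀ z : 𝔤, B * ‖z‖ < 1 / 4 → ∀ᶠ C in nhdsWithin B (Set.Ioi B), C * ‖z‖ < 1 / 4 :=
    fun z hz => ((continuous_mul_const ‖z‖).continuousWithinAt.tendsto.eventually_lt_const hz)
  obtain ⟨C, ⟨hCx, hCy⟩, hC⟩ := ((hlim x (hx.trans_le hK4)).and
    (hlim y (hy.trans_le hK4))).and self_mem_nhdsWithin |>.exists
  -- Recovering `‖Z_n‖` from the seminorm divides by the weight, so `B`, possibly zero, is enlarged
  -- to some `C > 0` that keeps both strict inequalities.
  have hBC : B < C := hC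
  lift C to NNReal using hB.trans hBC.le
  refine hα.summable_norm_bchTerm hι (B := C) (by exact_mod_cast hB.trans_lt hBC)
    (fun u v => (hbracket u v).trans (by gcongr)) x y ?_
  have h1 : Real.exp (C * ‖x‖) * Real.exp (C * ‖y‖) < Real.exp (1 / 2) := by
    rw [← Real.exp_add]
    exact Real.exp_lt_exp.2 (by linarith)
  refine h1.trans ?_
  -- The bound `1 / 4` on each side suffices because `1 / 2 < log 2`.
  rw [← Real.lt_log_iff_exp_lt two_pos]
  linarith [Real.log_two_gt_d9]
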